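/- All manifolds are real, finite-dimensional, without boundary and $C^\infty$ (connectedness and paracompactness are not needed), and all maps are $C^\infty$. Let $\pi\colon E\to M$ be a smooth (locally trivial) fibre bundle with $\dim M=m$; let $J^1E$ be the manifold of $1$-jets of local sections of $\pi$, whose points over $y\in E$, with $x=\pi(y)$, are identified with the tangent maps $T_x\phi$ of local sections $\phi$ with $\phi(x)=y$; let $\pi^1\colon J^1E\to E$ and $\bar\pi^1=\pi\circ\pi^1\colon J^1E\to M$ be the projections. For a local section $\phi\colon U\to E$ of $\pi$ ($U\subset M$ open) let $j^1\phi\colon U\to J^1E$ be its canonical prolongation $x\mapsto T_x\phi$. Let $\kappa\colon TJ^1E\to TE$ be the map $\kappa(\bar y,\bar u)=T_{\bar\pi^1(\bar y)}\phi\,(T_{\bar y}\bar\pi^1(\bar u))$, where $\phi$ is any representative of the jet $\bar y$. Let $X\in\mathcal X^m(J^1E)$ be an $m$-multivector field, that is, a smooth section of $\Lambda^mTJ^1E$. * $X$ is *integrable* if through every point of $J^1E$ there passes an integral manifold of $X$: an $m$-dimensional submanifold $S\hookrightarrow J^1E$ such that $X_p$ spans $\Lambda^mT_pS$ for every $p\in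 S$. * $X$ is *$\bar\pi^1$-transverse* if, at every $\bar y\in J^1E$, $(i(X)(\bar\pi^{1*}\omega))_{\bar y}\neq0$ for every $m$-form $\omega$ on $M$ with $\omega(\bar\pi^1(\bar y))\neq0$. * An *integral section* of $X$ is a local section $\psi\colon U\to J^1E$ of $\bar\pi^1$, $U\subset M$ open, whose image is an integral manifold of $X$; equivalently, $X_{\psi(x)}$ spans $\Lambda^m(T_x\psi(T_xM))$ for every $x\in U$. It is *holonomic* if $\psi=j^1\phi$ for some local section $\phi\colon U\to E$ of $\pi$. * $X$ is *holonomic* if it is integrable, $\bar\pi^1$-transverse, and all its integral sections are holonomic. * $X$ is *SOPDE* (semi-holonomic) if it is $\bar\pi^1$-transverse and $\Lambda^m\kappa\circ X=\Lambda^mT\pi^1\circ X$. **Theorem.** A multivector field $X\in\mathcal X^m(J^1E)$ is holonomic if and only if it is integrable and SOPDE. -/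

import Mathlib

open scoped Manifold ContDiff

noncomputable section

/-- A smooth fibre bundle `proj : E → M` with typical fibre `F`, over an `m`-dimensional manifold
`M`, with `n`-dimensional total space `E` and `k`-dimensional fibre `F`: around every point of the
base there is a local trivialization which is a diffeomorphism. -/
structure SmoothFiberBundle (m k n : ℕ) (M E F : Type*)
    [TopologicalSpace M] [ChartedSpace (EuclideanSpace ℝ (Fin m)) M] [IsManifold (𝓡 m) ∞ M]
    [TopologicalSpace E] [ChartedSpace (EuclideanSpace ℝ (Fin n)) E] [IsManifold (𝓡 n) ∞ E]
    [TopologicalSpace F] [ChartedSpace (EuclideanSpace ℝ (Fin k)) F] [IsManifold (𝓡 k) ∞ F] where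
  /-- the projection `π` -/
  proj : E → M
  exists_trivialization : ∀ x : M, ∃ e : Bundle.Trivialization F proj, x ∈ e.baseSet ∧
    ContMDiffOn (𝓡 n) ((𝓡 m).prod (𝓡 k)) ∞ e e.source ∧
    ContMDiffOn ((𝓡 m).prod (𝓡 k)) (𝓡 n) ∞ e.toOpenPartialHomeomorph.symm e.target

section JetBundle

variable {m k n : ℕ} {M E F : Type*}
  [TopologicalSpace M] [ChartedSpace (EuclideanSpace ℝ (Fin m)) M] [IsManifold (𝓡 m) ∞ M]
  [TopologicalSpace E] [ChartedSpace (EuclideanSpace ℝ (Fin n)) E] [IsManifold (𝓡 n) ∞ E]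
  [TopologicalSpace F] [ChartedSpace (EuclideanSpace ℝ (Fin k)) F] [IsManifold (𝓡 k) ∞ F]

theorem SmoothFiberBundle.contMDiff_proj (B : SmoothFiberBundle m k n M E F) :
    ContMDiff (𝓡 n) (𝓡 m) ∞ B.proj := by
  intro y
  obtain ⟨e, hx, h1, -⟩ := B.exists_trivialization (B.proj y)
  have hy : y ∈ e.source := by rw [e.source_eq]; exact hx
  have h2 : ContMDiffAt (𝓡 n) (𝓡 m) ∞ (fun z => (e z).1) y :=
    ((h1 y hy).contMDiffAt (e.open_source.mem_nhds hy)).fst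
  refine h2.congr_of_eventuallyEq ?_
  filter_upwards [e.open_source.mem_nhds hy] with z hz
  exact (e.proj_toFun z hz).symm

/-- The first jet bundle `J¹E`. The 1-jet at `x` of a local section `φ` of `π : E → M` is the
class of all local sections with the same value `y = φ x` and the same tangent map `T_xφ`; it is
recorded here as the pair `(y, T_xφ)`, where `x = π y` and `T_yπ ∘ T_xφ = id`. -/
structure J1 (B : SmoothFiberBundle m k n M E F) where
  /-- the projection `π¹ : J¹E → E` -/
  base : E
  /-- the tangent map `T_xφ` of any local section `φ` representing the jet -/
  lin : TangentSpace (𝓡 m) (B.proj base) →L[ℝ] TangentSpace (𝓡 n) base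
  proj_lin : (mfderiv (𝓡 n) (𝓡 m) B.proj base).comp lin =
    ContinuousLinearMap.id ℝ (TangentSpace (𝓡 m) (B.proj base))

/-- The space of natural coordinates `(x^μ, y^A, v^A_μ)`. -/
abbrev JetModel (m k : ℕ) : Type :=
  (EuclideanSpace ℝ (Fin m) × EuclideanSpace ℝ (Fin k)) ×
    (EuclideanSpace ℝ (Fin m) →L[ℝ] EuclideanSpace ℝ (Fin k))

/-- A chart `(x^μ, y^A)` of `E` adapted to the projection: `chart` is a smooth chart of `E`, and
its first component is a smooth chart `baseChart` of `M` composed with `π`. -/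
structure AdaptedChart (B : SmoothFiberBundle m k n M E F) where
  baseChart : OpenPartialHomeomorph M (EuclideanSpace ℝ (Fin m))
  chart : OpenPartialHomeomorph E (EuclideanSpace ℝ (Fin m) × EuclideanSpace ℝ (Fin k))
  smooth_base : ContMDiffOn (𝓡 m) (𝓡 m) ∞ baseChart baseChart.source
  smooth_base_symm : ContMDiffOn (𝓡 m) (𝓡 m) ∞ baseChart.symm baseChart.target
  smooth_chart : ContMDiffOn (𝓡 n)
    𝓘(ℝ, EuclideanSpace ℝ (Fin m) × EuclideanSpace ℝ (Fin k)) ∞ chart chart.source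
  smooth_chart_symm : ContMDiffOn 𝓘(ℝ, EuclideanSpace ℝ (Fin m) × EuclideanSpace ℝ (Fin k))
    (𝓡 n) ∞ chart.symm chart.target
  proj_mem : ∀ y ∈ chart.source, B.proj y ∈ baseChart.source
  fst_chart : ∀ y ∈ chart.source, (chart y).1 = baseChart (B.proj y)

theorem AdaptedChart.exists_mem_source (B : SmoothFiberBundle m k n M E F) (y : E) :
    ∃ A : AdaptedChart B, y ∈ A.chart.source := by
  obtain ⟨e, hx, h1, h2⟩ := B.exists_trivialization (B.proj y)
  have hy : y ∈ e.source := by rw [e.source_eq]; exact hx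
  let a := chartAt (EuclideanSpace ℝ (Fin m)) (B.proj y)
  let b := chartAt (EuclideanSpace ℝ (Fin k)) (e y).2
  have ha := contMDiffOn_chart (I := 𝓡 m) (n := ∞) (x := B.proj y)
  have ha' := contMDiffOn_chart_symm (I := 𝓡 m) (n := ∞) (x := B.proj y)
  have hb := contMDiffOn_chart (I := 𝓡 k) (n := ∞) (x := (e y).2)
  have hb' := contMDiffOn_chart_symm (I := 𝓡 k) (n := ∞) (x := (e y).2)
  let c : OpenPartialHomeomorph E (EuclideanSpace ℝ (Fin m) × EuclideanSpace ℝ (Fin k)) :=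
    e.toOpenPartialHomeomorph.trans (a.prod b)
  have hsrc : ∀ z ∈ c.source, z ∈ e.source ∧ (e z).1 ∈ a.source ∧ (e z).2 ∈ b.source := by
    intro z hz
    rw [OpenPartialHomeomorph.trans_source] at hz
    exact ⟨hz.1, hz.2.1, hz.2.2⟩
  have htgt : ∀ z ∈ c.target, z.1 ∈ a.target ∧ z.2 ∈ b.target ∧
      (a.symm z.1, b.symm z.2) ∈ e.target := by
    intro z hz
    rw [OpenPartialHomeomorph.trans_target] at hz
    exact ⟨hz.1.1, hz.1.2, hz.2⟩
  refine ⟨⟨a, c, ha, ha', ?_, ?_, ?_, ?_⟩, ?_⟩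
  · have h3 : ContMDiffOn (𝓡 n) (𝓡 m) ∞ (fun z => a (e z).1) c.source :=
      ha.comp (fun z hz => (h1.mono (fun w hw => (hsrc w hw).1) z hz).fst)
        (fun z hz => (hsrc z hz).2.1)
    have h4 : ContMDiffOn (𝓡 n) (𝓡 k) ∞ (fun z => b (e z).2) c.source :=
      hb.comp (fun z hz => (h1.mono (fun w hw => (hsrc w hw).1) z hz).snd)
        (fun z hz => (hsrc z hz).2.2)
    exact h3.prodMk_space h4
  · have h3 : ContMDiffOn 𝓘(ℝ, EuclideanSpace ℝ (Fin m) × EuclideanSpace ℝ (Fin k)) (𝓡 m) ∞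
        (fun z => a.symm z.1) c.target :=
      ha'.comp (contDiff_fst.contMDiff.contMDiffOn) (fun z hz => (htgt z hz).1)
    have h4 : ContMDiffOn 𝓘(ℝ, EuclideanSpace ℝ (Fin m) × EuclideanSpace ℝ (Fin k)) (𝓡 k) ∞
        (fun z => b.symm z.2) c.target :=
      hb'.comp (contDiff_snd.contMDiff.contMDiffOn) (fun z hz => (htgt z hz).2.1)
    exact h2.comp (h3.prodMk h4) (fun z hz => (htgt z hz).2.2)
  · intro z hz
    rw [← e.proj_toFun z (hsrc z hz).1]
    exact (hsrc z hz).2.1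
  · intro z hz
    rw [← e.proj_toFun z (hsrc z hz).1]
    rfl
  · change y ∈ c.source
    rw [OpenPartialHomeomorph.trans_source]
    refine ⟨hy, ?_, mem_chart_source _ _⟩
    change (e y).1 ∈ a.source
    have : (e y).1 = B.proj y := e.proj_toFun y hy
    rw [this]
    exact mem_chart_source _ _

theorem J1.ext_of_eq {B : SmoothFiberBundle m k n M E F} {y z : J1 B} (h : y.base = z.base)
    (h' : (y.lin : EuclideanSpace ℝ (Fin m) →L[ℝ] EuclideanSpace ℝ (Fin n)) = z.lin) :
    y = z := by
  obtain ⟨b, l, hl⟩ := y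
  obtain ⟨b', l', hl'⟩ := z
  obtain rfl : b = b' := h
  obtain rfl : l = l' := h'
  rfl

namespace AdaptedChart

variable {B : SmoothFiberBundle m k n M E F} (A : AdaptedChart B)

/-- The tangent map of an adapted chart. -/
def dchart (y : E) :
    EuclideanSpace ℝ (Fin n) →L[ℝ] EuclideanSpace ℝ (Fin m) × EuclideanSpace ℝ (Fin k) :=
  mfderiv (𝓡 n) 𝓘(ℝ, EuclideanSpace ℝ (Fin m) × EuclideanSpace ℝ (Fin k)) A.chart y

/-- The tangent map of the inverse of an adapted chart. -/
def dchartSymm (z : EuclideanSpace ℝ (Fin m) × EuclideanSpace ℝ (Fin k)) :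
    EuclideanSpace ℝ (Fin m) × EuclideanSpace ℝ (Fin k) →L[ℝ] EuclideanSpace ℝ (Fin n) :=
  mfderiv 𝓘(ℝ, EuclideanSpace ℝ (Fin m) × EuclideanSpace ℝ (Fin k)) (𝓡 n) A.chart.symm z

/-- The tangent map of the base chart. -/
def dbase (x : M) : EuclideanSpace ℝ (Fin m) →L[ℝ] EuclideanSpace ℝ (Fin m) :=
  mfderiv (𝓡 m) (𝓡 m) A.baseChart x

/-- The tangent map of the inverse of the base chart. -/
def dbaseSymm (u : EuclideanSpace ℝ (Fin m)) :
    EuclideanSpace ℝ (Fin m) →L[ℝ] EuclideanSpace ℝ (Fin m) :=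
  mfderiv (𝓡 m) (𝓡 m) A.baseChart.symm u

theorem mdiff_chart {y : E} (hy : y ∈ A.chart.source) :
    MDifferentiableAt (𝓡 n) 𝓘(ℝ, EuclideanSpace ℝ (Fin m) × EuclideanSpace ℝ (Fin k))
      A.chart y :=
  ((A.smooth_chart y hy).contMDiffAt (A.chart.open_source.mem_nhds hy)).mdifferentiableAt (by simp)

theorem mdiff_chart_symm {z : EuclideanSpace ℝ (Fin m) × EuclideanSpace ℝ (Fin k)}
    (hz : z ∈ A.chart.target) :
    MDifferentiableAt 𝓘(ℝ, EuclideanSpace ℝ (Fin m) × EuclideanSpace ℝ (Fin k)) (𝓡 n)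
      A.chart.symm z :=
  ((A.smooth_chart_symm z hz).contMDiffAt
    (A.chart.open_target.mem_nhds hz)).mdifferentiableAt (by simp)

theorem mdiff_base {x : M} (hx : x ∈ A.baseChart.source) :
    MDifferentiableAt (𝓡 m) (𝓡 m) A.baseChart x :=
  ((A.smooth_base x hx).contMDiffAt
    (A.baseChart.open_source.mem_nhds hx)).mdifferentiableAt (by simp)

theorem mdiff_base_symm {u : EuclideanSpace ℝ (Fin m)} (hu : u ∈ A.baseChart.target) :
    MDifferentiableAt (𝓡 m) (𝓡 m) A.baseChart.symm u :=
  ((A.smooth_base_symm u hu).contMDiffAt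
    (A.baseChart.open_target.mem_nhds hu)).mdifferentiableAt (by simp)

theorem mdiff_proj (B : SmoothFiberBundle m k n M E F) (y : E) :
    MDifferentiableAt (𝓡 n) (𝓡 m) B.proj y :=
  (B.contMDiff_proj y).mdifferentiableAt (by simp)

theorem dchartSymm_comp_dchart {y : E} (hy : y ∈ A.chart.source) :
    (A.dchartSymm (A.chart y)).comp (A.dchart y) = ContinuousLinearMap.id ℝ _ := by
  have h := mfderiv_comp y (A.mdiff_chart_symm (A.chart.map_source hy)) (A.mdiff_chart hy)
  have h2 : (A.chart.symm ∘ A.chart) =ᶠ[nhds y] id := A.chart.eventually_left_inverse hy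
  rw [h2.mfderiv_eq, mfderiv_id] at h
  exact h.symm

theorem dchart_comp_dchartSymm {z : EuclideanSpace ℝ (Fin m) × EuclideanSpace ℝ (Fin k)}
    (hz : z ∈ A.chart.target) :
    (A.dchart (A.chart.symm z)).comp (A.dchartSymm z) = ContinuousLinearMap.id ℝ _ := by
  have h := mfderiv_comp z (A.mdiff_chart (A.chart.map_target hz)) (A.mdiff_chart_symm hz)
  have h2 : (A.chart ∘ A.chart.symm) =ᶠ[nhds z] id := A.chart.eventually_right_inverse hz
  rw [h2.mfderiv_eq, mfderiv_id] at h
  exact h.symm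

theorem dbaseSymm_comp_dbase {x : M} (hx : x ∈ A.baseChart.source) :
    (A.dbaseSymm (A.baseChart x)).comp (A.dbase x) = ContinuousLinearMap.id ℝ _ := by
  have h := mfderiv_comp x (A.mdiff_base_symm (A.baseChart.map_source hx)) (A.mdiff_base hx)
  have h2 : (A.baseChart.symm ∘ A.baseChart) =ᶠ[nhds x] id :=
    A.baseChart.eventually_left_inverse hx
  rw [h2.mfderiv_eq, mfderiv_id] at h
  exact h.symm

theorem dbase_comp_dbaseSymm {u : EuclideanSpace ℝ (Fin m)} (hu : u ∈ A.baseChart.target) :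
    (A.dbase (A.baseChart.symm u)).comp (A.dbaseSymm u) = ContinuousLinearMap.id ℝ _ := by
  have h := mfderiv_comp u (A.mdiff_base (A.baseChart.map_target hu)) (A.mdiff_base_symm hu)
  have h2 : (A.baseChart ∘ A.baseChart.symm) =ᶠ[nhds u] id :=
    A.baseChart.eventually_right_inverse hu
  rw [h2.mfderiv_eq, mfderiv_id] at h
  exact h.symm

/-- The tangent map of the bundle projection, in the model spaces. -/
def dproj (B : SmoothFiberBundle m k n M E F) (y : E) :
    EuclideanSpace ℝ (Fin n) →L[ℝ] EuclideanSpace ℝ (Fin m) :=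
  mfderiv (𝓡 n) (𝓡 m) B.proj y

theorem fst_comp_dchart {y : E} (hy : y ∈ A.chart.source) :
    (ContinuousLinearMap.fst ℝ _ _).comp (A.dchart y) = (A.dbase (B.proj y)).comp (dproj B y) := by
  have h := mfderiv_comp y (A.mdiff_base (A.proj_mem y hy)) (mdiff_proj B y)
  have h1 := mfderiv_comp y (g := (Prod.fst : EuclideanSpace ℝ (Fin m) ×
    EuclideanSpace ℝ (Fin k) → EuclideanSpace ℝ (Fin m)))
    (I'' := 𝓡 m) (differentiableAt_fst.mdifferentiableAt) (A.mdiff_chart hy)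
  have h2 : (Prod.fst ∘ A.chart) =ᶠ[nhds y] (A.baseChart ∘ B.proj) := by
    filter_upwards [A.chart.open_source.mem_nhds hy] with w hw using A.fst_chart w hw
  rw [h2.mfderiv_eq, h, mfderiv_eq_fderiv, fderiv_fst] at h1
  exact h1.symm

theorem dproj_comp_dchartSymm {z : EuclideanSpace ℝ (Fin m) × EuclideanSpace ℝ (Fin k)}
    (hz : z ∈ A.chart.target) :
    (dproj B (A.chart.symm z)).comp (A.dchartSymm z) =
      (A.dbaseSymm (A.baseChart (B.proj (A.chart.symm z)))).comp
        (ContinuousLinearMap.fst ℝ _ _) := by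
  have hy := A.chart.map_target hz
  have h1 := A.fst_comp_dchart hy
  have h2 := A.dbaseSymm_comp_dbase (A.proj_mem _ hy)
  have h3 := A.dchart_comp_dchartSymm hz
  calc (dproj B (A.chart.symm z)).comp (A.dchartSymm z)
      = ((A.dbaseSymm (A.baseChart (B.proj (A.chart.symm z)))).comp
          ((A.dbase (B.proj (A.chart.symm z))).comp (dproj B (A.chart.symm z)))).comp
            (A.dchartSymm z) := by
        rw [← ContinuousLinearMap.comp_assoc, h2, ContinuousLinearMap.id_comp]
    _ = (A.dbaseSymm (A.baseChart (B.proj (A.chart.symm z)))).comp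
        ((ContinuousLinearMap.fst ℝ _ _).comp
          ((A.dchart (A.chart.symm z)).comp (A.dchartSymm z))) := by
        rw [← h1]; rfl
    _ = _ := by rw [h3, ContinuousLinearMap.comp_id]

/-- The natural coordinates `(x^μ, y^A, v^A_μ)` of a jet: `v` is the fibre component of the
tangent map of a representative, in the coordinates of the adapted chart. -/
def jetCoord (p : J1 B) : JetModel m k :=
  (A.chart p.base,
    (ContinuousLinearMap.snd ℝ (EuclideanSpace ℝ (Fin m)) (EuclideanSpace ℝ (Fin k))).comp
      ((A.dchart p.base).comp
        ((show EuclideanSpace ℝ (Fin m) →L[ℝ] EuclideanSpace ℝ (Fin n) from p.lin).comp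
          (A.dbaseSymm (A.baseChart (B.proj p.base))))))

/-- The tangent map with natural coordinates `w`. -/
def linOfCoord (w : JetModel m k) :
    EuclideanSpace ℝ (Fin m) →L[ℝ] EuclideanSpace ℝ (Fin n) :=
  (A.dchartSymm w.1).comp
    (((ContinuousLinearMap.id ℝ _).prod w.2).comp
      (A.dbase (B.proj (A.chart.symm w.1))))

/-- The jet with natural coordinates `w`. -/
def jetOfCoord (w : JetModel m k) (hw : w.1 ∈ A.chart.target) : J1 B where
  base := A.chart.symm w.1
  lin := A.linOfCoord w
  proj_lin := by
    change (dproj B _).comp (A.linOfCoord w) = _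
    have h2 := A.dbaseSymm_comp_dbase (A.proj_mem _ (A.chart.map_target hw))
    rw [linOfCoord, ← ContinuousLinearMap.comp_assoc, A.dproj_comp_dchartSymm hw]
    rw [ContinuousLinearMap.comp_assoc, ← ContinuousLinearMap.comp_assoc
      (ContinuousLinearMap.fst ℝ _ _), ContinuousLinearMap.fst_comp_prod,
      ContinuousLinearMap.id_comp]
    exact h2

open Classical in
/-- The natural chart of `J¹E` induced by an adapted chart of `E`. The jet `p₀` is only the junk
value of the inverse outside of the target. -/
def jetChart (p₀ : J1 B) : PartialEquiv (J1 B) (JetModel m k) where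
  toFun := A.jetCoord
  invFun w := if hw : w.1 ∈ A.chart.target then A.jetOfCoord w hw else p₀
  source := {p | p.base ∈ A.chart.source}
  target := {w | w.1 ∈ A.chart.target}
  map_source' p hp := A.chart.map_source hp
  map_target' w hw := by
    have hw' : w.1 ∈ A.chart.target := hw
    rw [dif_pos hw']
    exact A.chart.map_target hw'
  left_inv' p hp := by
    have hp' : p.base ∈ A.chart.source := hp
    have hw : (A.jetCoord p).1 ∈ A.chart.target := A.chart.map_source hp'
    rw [dif_pos hw]
    have hb : A.chart.symm (A.jetCoord p).1 = p.base := A.chart.left_inv hp'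
    refine J1.ext_of_eq hb ?_
    change A.linOfCoord (A.jetCoord p) = _
    rw [linOfCoord, hb]
    generalize hl : (show EuclideanSpace ℝ (Fin m) →L[ℝ] EuclideanSpace ℝ (Fin n) from p.lin) = l
    have hpl : (dproj B p.base).comp l = ContinuousLinearMap.id ℝ _ := by
      rw [← hl]; exact p.proj_lin
    have hB := A.proj_mem _ hp'
    have h1 : (ContinuousLinearMap.id ℝ (EuclideanSpace ℝ (Fin m))).prod (A.jetCoord p).2 = (A.dchart p.base).comp
        (l.comp (A.dbaseSymm (A.baseChart (B.proj p.base)))) := by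
      have h2 : (ContinuousLinearMap.fst ℝ _ _).comp ((A.dchart p.base).comp
          (l.comp (A.dbaseSymm (A.baseChart (B.proj p.base))))) =
          ContinuousLinearMap.id ℝ _ := by
        have h3 := A.dbase_comp_dbaseSymm (A.baseChart.map_source hB)
        rw [A.baseChart.left_inv hB] at h3
        rw [← ContinuousLinearMap.comp_assoc, A.fst_comp_dchart hp',
          ContinuousLinearMap.comp_assoc, ← ContinuousLinearMap.comp_assoc (dproj B p.base),
          hpl, ContinuousLinearMap.id_comp, h3]
      rw [← h2, jetCoord, hl]
      rfl
    rw [h1]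
    refine Eq.trans ?_ hl.symm
    change (A.dchartSymm (A.chart p.base)).comp (((A.dchart p.base).comp
      (l.comp (A.dbaseSymm (A.baseChart (B.proj p.base))))).comp (A.dbase (B.proj p.base))) = l
    rw [ContinuousLinearMap.comp_assoc, ContinuousLinearMap.comp_assoc,
      A.dbaseSymm_comp_dbase hB, ContinuousLinearMap.comp_id, ← ContinuousLinearMap.comp_assoc,
      A.dchartSymm_comp_dchart hp', ContinuousLinearMap.id_comp]
  right_inv' w hw := by
    have hw' : w.1 ∈ A.chart.target := hw
    rw [dif_pos hw']
    have hy := A.chart.map_target hw'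
    have hB := A.proj_mem _ hy
    refine Prod.ext (A.chart.right_inv hw') ?_
    change (ContinuousLinearMap.snd ℝ (EuclideanSpace ℝ (Fin m)) (EuclideanSpace ℝ (Fin k))).comp
      ((A.dchart (A.chart.symm w.1)).comp ((A.linOfCoord w).comp (A.dbaseSymm (A.baseChart (B.proj (A.chart.symm w.1)))))) = w.2
    have h3 := A.dbase_comp_dbaseSymm (A.baseChart.map_source hB)
    rw [A.baseChart.left_inv hB] at h3
    rw [linOfCoord, ContinuousLinearMap.comp_assoc, ContinuousLinearMap.comp_assoc, h3,
      ContinuousLinearMap.comp_id, ← ContinuousLinearMap.comp_assoc (A.dchart _),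
      A.dchart_comp_dchartSymm hw', ContinuousLinearMap.id_comp,
      ContinuousLinearMap.snd_comp_prod]

open Classical in
theorem jetChart_trans_source (A A' : AdaptedChart B) (p q : J1 B) :
    ((A.jetChart p).symm.trans (A'.jetChart q)).source =
      Prod.fst ⁻¹' (A.chart.symm.trans A'.chart).source := by
  ext w
  rw [PartialEquiv.trans_source, Set.mem_preimage, OpenPartialHomeomorph.trans_source]
  refine and_congr_right fun (hw : w.1 ∈ A.chart.target) => ?_
  change (A.jetChart p).symm w ∈ (A'.jetChart q).source ↔ A.chart.symm w.1 ∈ A'.chart.source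
  change (if hw : w.1 ∈ A.chart.target then A.jetOfCoord w hw else p).base ∈ A'.chart.source ↔ _
  rw [dif_pos hw]
  rfl

open Classical in
theorem contDiffOn_jetChart_trans (A A' : AdaptedChart B) (p q : J1 B) :
    ContDiffOn ℝ ∞ ((A.jetChart p).symm.trans (A'.jetChart q))
      ((A.jetChart p).symm.trans (A'.jetChart q)).source := by
  let τ := A.chart.symm.trans A'.chart
  let σ := A'.baseChart.symm.trans A.baseChart
  have hτ : ContDiffOn ℝ ∞ τ τ.source := by
    rw [← contMDiffOn_iff_contDiffOn]
    exact A'.smooth_chart.comp (A.smooth_chart_symm.mono fun w hw => hw.1) fun w hw => hw.2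
  have hσ : ContDiffOn ℝ ∞ σ σ.source := by
    rw [← contMDiffOn_iff_contDiffOn]
    exact A.smooth_base.comp (A'.smooth_base_symm.mono fun w hw => hw.1) fun w hw => hw.2
  have hτ' : ContDiffOn ℝ ∞ (fderiv ℝ τ) τ.source :=
    hτ.fderiv_of_isOpen τ.open_source (by simp)
  have hσ' : ContDiffOn ℝ ∞ (fderiv ℝ σ) σ.source :=
    hσ.fderiv_of_isOpen σ.open_source (by simp)
  rw [jetChart_trans_source]
  have hfst : ContDiffOn ℝ ∞ (Prod.fst : JetModel m k → _) (Prod.fst ⁻¹' τ.source) :=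
    contDiff_fst.contDiffOn
  have h1 := hτ.comp hfst (fun w hw => hw)
  have h2 := hτ'.comp hfst (fun w hw => hw)
  have hbase : ∀ w : JetModel m k, w.1 ∈ τ.source →
      (τ w.1).1 = A'.baseChart (B.proj (A.chart.symm w.1)) ∧
      B.proj (A.chart.symm w.1) ∈ A.baseChart.source ∧
      B.proj (A.chart.symm w.1) ∈ A'.baseChart.source := by
    intro w hw
    exact ⟨A'.fst_chart _ hw.2, A.proj_mem _ (A.chart.map_target hw.1), A'.proj_mem _ hw.2⟩
  have hmem : ∀ w : JetModel m k, w.1 ∈ τ.source → (τ w.1).1 ∈ σ.source := by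
    intro w hw
    obtain ⟨e1, e2, e3⟩ := hbase w hw
    rw [e1]
    refine ⟨A'.baseChart.map_source e3, ?_⟩
    change A'.baseChart.symm (A'.baseChart (B.proj (A.chart.symm w.1))) ∈ A.baseChart.source
    rw [A'.baseChart.left_inv e3]
    exact e2
  have h3 : ContDiffOn ℝ ∞ (fun w : JetModel m k => fderiv ℝ σ (τ w.1).1)
      (Prod.fst ⁻¹' τ.source) :=
    hσ'.comp (contDiff_fst.comp_contDiffOn h1) hmem
  have h4 : ContDiffOn ℝ ∞ (fun w : JetModel m k =>
      ((ContinuousLinearMap.inl ℝ (EuclideanSpace ℝ (Fin m)) (EuclideanSpace ℝ (Fin k))) +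
      (ContinuousLinearMap.inr ℝ (EuclideanSpace ℝ (Fin m)) (EuclideanSpace ℝ (Fin k))).comp w.2))
      (Prod.fst ⁻¹' τ.source) :=
    contDiffOn_const.add (contDiffOn_const.clm_comp contDiff_snd.contDiffOn)
  have h5 := h1.prodMk ((contDiffOn_const (c := ContinuousLinearMap.snd ℝ
    (EuclideanSpace ℝ (Fin m)) (EuclideanSpace ℝ (Fin k)))).clm_comp
      (h2.clm_comp (h4.clm_comp h3)))
  refine h5.congr fun w hw => ?_
  have hw1 : w.1 ∈ A.chart.target := hw.1
  have hw2 : A.chart.symm w.1 ∈ A'.chart.source := hw.2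
  obtain ⟨e1, e2, e3⟩ := hbase w hw
  change A'.jetCoord (if hw : w.1 ∈ A.chart.target then A.jetOfCoord w hw else p) = _
  rw [dif_pos hw1]
  refine Prod.ext rfl ?_
  change (ContinuousLinearMap.snd ℝ _ _).comp ((A'.dchart (A.chart.symm w.1)).comp
      ((A.linOfCoord w).comp (A'.dbaseSymm (A'.baseChart (B.proj (A.chart.symm w.1)))))) =
    (ContinuousLinearMap.snd ℝ _ _).comp ((fderiv ℝ τ w.1).comp
      ((ContinuousLinearMap.inl ℝ _ _ + (ContinuousLinearMap.inr ℝ _ _).comp w.2).comp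
        (fderiv ℝ σ (τ w.1).1)))
  have k1 : fderiv ℝ τ w.1 = (A'.dchart (A.chart.symm w.1)).comp (A.dchartSymm w.1) := by
    have h := mfderiv_comp w.1 (A'.mdiff_chart hw2) (A.mdiff_chart_symm hw1)
    rw [mfderiv_eq_fderiv] at h
    exact h
  have k2 : fderiv ℝ σ (τ w.1).1 = (A.dbase (B.proj (A.chart.symm w.1))).comp
      (A'.dbaseSymm (A'.baseChart (B.proj (A.chart.symm w.1)))) := by
    rw [e1]
    have h := mfderiv_comp (I' := 𝓡 m) (g := A.baseChart) (f := A'.baseChart.symm)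
      (A'.baseChart (B.proj (A.chart.symm w.1)))
      (by rw [A'.baseChart.left_inv e3]; exact A.mdiff_base e2)
      (A'.mdiff_base_symm (A'.baseChart.map_source e3))
    rw [mfderiv_eq_fderiv, A'.baseChart.left_inv e3] at h
    exact h
  have k3 : (ContinuousLinearMap.inl ℝ (EuclideanSpace ℝ (Fin m)) (EuclideanSpace ℝ (Fin k))) +
      (ContinuousLinearMap.inr ℝ _ _).comp w.2 = (ContinuousLinearMap.id ℝ _).prod w.2 := by
    ext v <;> simp
  rw [k1, k2, k3, linOfCoord]
  rfl

end AdaptedChart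

namespace J1

variable (B : SmoothFiberBundle m k n M E F)

/-- The natural charts of `J¹E`. -/
def core : ChartedSpaceCore (JetModel m k) (J1 B) where
  atlas := {e | ∃ (A : AdaptedChart B) (p : J1 B), e = A.jetChart p}
  chartAt p := (AdaptedChart.exists_mem_source B p.base).choose.jetChart p
  mem_chart_source p := (AdaptedChart.exists_mem_source B p.base).choose_spec
  chart_mem_atlas p := ⟨_, p, rfl⟩
  open_source := by
    rintro _ _ ⟨A, p, rfl⟩ ⟨A', q, rfl⟩
    rw [AdaptedChart.jetChart_trans_source]
    exact (A.chart.symm.trans A'.chart).open_source.preimage continuous_fst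
  continuousOn_toFun := by
    rintro _ _ ⟨A, p, rfl⟩ ⟨A', q, rfl⟩
    exact (A.contDiffOn_jetChart_trans A' p q).continuousOn

instance instTopologicalSpace : TopologicalSpace (J1 B) := (core B).toTopologicalSpace

instance instChartedSpace : ChartedSpace (JetModel m k) (J1 B) := (core B).toChartedSpace

instance instIsManifold : IsManifold 𝓘(ℝ, JetModel m k) ∞ (J1 B) := by
  apply isManifold_of_contDiffOn
  intro e e' he he'
  obtain ⟨_, ⟨f, rfl⟩, hf⟩ := he
  obtain ⟨_, ⟨hf', rfl⟩, rfl⟩ := hf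
  obtain ⟨_, ⟨g, rfl⟩, hg⟩ := he'
  obtain ⟨_, ⟨hg', rfl⟩, rfl⟩ := hg
  obtain ⟨A, p, rfl⟩ := hf'
  obtain ⟨A', q, rfl⟩ := hg'
  refine (A.contDiffOn_jetChart_trans A' p q).mono ?_
  intro w hw
  exact hw.1

variable {B}

/-- The projection `π̄¹ = π ∘ π¹ : J¹E → M`. -/
def toBase (p : J1 B) : M := B.proj p.base

/-- The map `κ : TJ¹E → TE`, `κ(ȳ, u) = T_xφ (T_ȳ π̄¹ u)` for a representative `φ` of `ȳ`. -/
def kappa (p : J1 B) : TangentSpace 𝓘(ℝ, JetModel m k) p →L[ℝ] TangentSpace (𝓡 n) p.base :=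
  p.lin.comp (mfderiv 𝓘(ℝ, JetModel m k) (𝓡 m) (toBase (B := B)) p)

theorem contMDiff_base : ContMDiff 𝓘(ℝ, JetModel m k) (𝓡 n) ∞ (base (B := B)) := by
  intro p
  let A := (AdaptedChart.exists_mem_source B p.base).choose
  have hA : p.base ∈ A.chart.source := (AdaptedChart.exists_mem_source B p.base).choose_spec
  have h1 : ContMDiffAt 𝓘(ℝ, JetModel m k) 𝓘(ℝ, JetModel m k) ∞ (chartAt (JetModel m k) p) p :=
    (contMDiffOn_chart (I := 𝓘(ℝ, JetModel m k)) (n := ∞) (x := p)).contMDiffAt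
      ((chartAt (JetModel m k) p).open_source.mem_nhds (mem_chart_source _ p))
  have h2 : ContMDiffAt 𝓘(ℝ, JetModel m k)
      𝓘(ℝ, EuclideanSpace ℝ (Fin m) × EuclideanSpace ℝ (Fin k)) ∞
      (fun q : J1 B => (chartAt (JetModel m k) p q).1) p :=
    (contDiff_fst.contMDiff.contMDiffAt).comp p h1
  have h3 : (chartAt (JetModel m k) p p).1 ∈ A.chart.target := A.chart.map_source hA
  have h4 := ((A.smooth_chart_symm _ h3).contMDiffAt (A.chart.open_target.mem_nhds h3)).comp p h2
  refine h4.congr_of_eventuallyEq ?_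
  filter_upwards [(chartAt (JetModel m k) p).open_source.mem_nhds (mem_chart_source _ p)]
    with q hq
  exact (A.chart.left_inv hq).symm

end J1

end JetBundle

/-! ### Multivector fields -/

section Multivector

/-- A smooth `m`-multivector field on a manifold `N` modelled on `V`: a section of `Λ^m TN` whose
components in every preferred chart of `N` are smooth. The components are read off by the linear
functionals on `Λ^m V`. -/
structure MultivectorField (V : Type*) [NormedAddCommGroup V] [NormedSpace ℝ V] (m : ℕ)
    (N : Type*) [TopologicalSpace N] [ChartedSpace V N] [IsManifold 𝓘(ℝ, V) ∞ N] where
  toFun : ∀ p : N, ⋀[ℝ]^m (TangentSpace 𝓘(ℝ, V) p)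
  smooth : ∀ (p₀ : N) (ℓ : ⋀[ℝ]^m V →ₗ[ℝ] ℝ),
    ContMDiffOn 𝓘(ℝ, V) 𝓘(ℝ, ℝ) ∞
      (fun p => ℓ (exteriorPower.map m
        (mfderiv 𝓘(ℝ, V) 𝓘(ℝ, V) (chartAt V p₀) p).toLinearMap (toFun p)))
      (chartAt V p₀).source

namespace MultivectorField

variable {V : Type*} [NormedAddCommGroup V] [NormedSpace ℝ V] {m : ℕ}
  {N : Type*} [TopologicalSpace N] [ChartedSpace V N] [IsManifold 𝓘(ℝ, V) ∞ N]

/-- An (immersed) `m`-dimensional submanifold `ι : S ↪ N` is an integral manifold of `X` iff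
`X_p` spans `Λ^m T_pS` at every point `p` of `S`. -/
structure IsIntegralManifold (X : MultivectorField V m N) {S : Type*} [TopologicalSpace S]
    [ChartedSpace (EuclideanSpace ℝ (Fin m)) S] [IsManifold (𝓡 m) ∞ S] (ι : S → N) : Prop where
  injective : Function.Injective ι
  smooth : ContMDiff (𝓡 m) 𝓘(ℝ, V) ∞ ι
  immersion : ∀ s, Function.Injective (mfderiv (𝓡 m) 𝓘(ℝ, V) ι s)
  span_eq : ∀ s, Submodule.span ℝ {X.toFun (ι s)} =
    LinearMap.range (exteriorPower.map m (mfderiv (𝓡 m) 𝓘(ℝ, V) ι s).toLinearMap)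

/-- `X` is integrable iff every point of `N` lies on an integral manifold of `X`. -/
def IsIntegrable.{u, v} {V : Type v} [NormedAddCommGroup V] [NormedSpace ℝ V] {m : ℕ}
    {N : Type u} [TopologicalSpace N] [ChartedSpace V N] [IsManifold 𝓘(ℝ, V) ∞ N]
    (X : MultivectorField V m N) : Prop :=
  ∀ p : N, ∃ (S : Type u) (_ : TopologicalSpace S)
    (_ : ChartedSpace (EuclideanSpace ℝ (Fin m)) S) (_ : IsManifold (𝓡 m) ∞ S) (ι : S → N),
    X.IsIntegralManifold ι ∧ p ∈ Set.range ι

/-- `X` is transverse to `p : N → M` iff, at every point `q` of `N`, the contraction of `X` with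
`p^*ω` does not vanish at `q`, for every `m`-form `ω` with `ω (p q) ≠ 0`. The number
`(i(X) p^*ω)(q)` only depends on the alternating form `ω (p q)` on `T_{p q}M`; on `Y₁ ∧ ⋯ ∧ Y_m` it
is `(p^*ω)(Y₁, …, Y_m)` (up to a sign convention depending on `m` only). -/
def IsTransverse {M : Type*} [TopologicalSpace M] [ChartedSpace (EuclideanSpace ℝ (Fin m)) M]
    (X : MultivectorField V m N) (p : N → M) : Prop :=
  ∀ (q : N) (α : (TangentSpace (𝓡 m) (p q)) [⋀^Fin m]→ₗ[ℝ] ℝ), α ≠ 0 →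
    exteriorPower.alternatingMapLinearEquiv
      (α.compLinearMap (mfderiv 𝓘(ℝ, V) (𝓡 m) p q).toLinearMap) (X.toFun q) ≠ 0

end MultivectorField

/-- `σ` is a smooth local section of `p : P → M` over the open set `U ⊆ M`. (The values of `σ`
outside of `U` are irrelevant; `V` is the model space of `P`.) -/
structure IsLocalSection (m : ℕ) (V : Type*) [NormedAddCommGroup V] [NormedSpace ℝ V]
    {M P : Type*} [TopologicalSpace M] [ChartedSpace (EuclideanSpace ℝ (Fin m)) M]
    [TopologicalSpace P] [ChartedSpace V P] (p : P → M) (U : Set M) (σ : M → P) : Prop where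
  isOpen : IsOpen U
  smooth : ContMDiffOn (𝓡 m) 𝓘(ℝ, V) ∞ σ U
  proj : ∀ x ∈ U, p (σ x) = x

/-- `ψ` is an integral section of `X` over `U`: a local section of `p : N → M` over `U` whose image
is an integral manifold of `X`, that is, `X_{ψ x}` spans `Λ^m T_{ψ x}(ψ(U))` for `x ∈ U`. -/
structure MultivectorField.IsIntegralSection {m : ℕ} {V : Type*} [NormedAddCommGroup V]
    [NormedSpace ℝ V] {N M : Type*} [TopologicalSpace N] [ChartedSpace V N]
    [IsManifold 𝓘(ℝ, V) ∞ N] [TopologicalSpace M] [ChartedSpace (EuclideanSpace ℝ (Fin m)) M]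
    (X : MultivectorField V m N) (p : N → M) (U : Set M) (ψ : M → N) : Prop where
  isLocalSection : IsLocalSection m V p U ψ
  span_eq : ∀ x ∈ U, Submodule.span ℝ {X.toFun (ψ x)} =
    LinearMap.range (exteriorPower.map m (mfderiv (𝓡 m) 𝓘(ℝ, V) ψ x).toLinearMap)

end Multivector

section Holonomic

variable {m k n : ℕ} {M E F : Type*}
  [TopologicalSpace M] [ChartedSpace (EuclideanSpace ℝ (Fin m)) M] [IsManifold (𝓡 m) ∞ M]
  [TopologicalSpace E] [ChartedSpace (EuclideanSpace ℝ (Fin n)) E] [IsManifold (𝓡 n) ∞ E]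
  [TopologicalSpace F] [ChartedSpace (EuclideanSpace ℝ (Fin k)) F] [IsManifold (𝓡 k) ∞ F]
  {B : SmoothFiberBundle m k n M E F}

/-- The canonical prolongation `j¹φ` of a local section `φ` of `π`, at a point of its domain. -/
def J1.prolong {U : Set M} {φ : M → E} (h : IsLocalSection m (EuclideanSpace ℝ (Fin n)) B.proj U φ) (x : M) (hx : x ∈ U) :
    J1 B where
  base := φ x
  lin := mfderiv (𝓡 m) (𝓡 n) φ x
  proj_lin := by
    have h1 : MDifferentiableAt (𝓡 m) (𝓡 n) φ x :=
      ((h.smooth x hx).contMDiffAt (h.isOpen.mem_nhds hx)).mdifferentiableAt (by simp)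
    have h2 := mfderiv_comp x (AdaptedChart.mdiff_proj B (φ x)) h1
    have h3 : (B.proj ∘ φ) =ᶠ[nhds x] id := by
      filter_upwards [h.isOpen.mem_nhds hx] with z hz using h.proj z hz
    rw [h3.mfderiv_eq, mfderiv_id] at h2
    exact h2.symm

/-- A local section `ψ` of `π̄¹` over `U` is holonomic iff `ψ = j¹φ` for some local section `φ` of
`π` over `U`. -/
def IsHolonomicSection (U : Set M) (ψ : M → J1 B) : Prop :=
  ∃ (φ : M → E) (h : IsLocalSection m (EuclideanSpace ℝ (Fin n)) B.proj U φ), ∀ (x : M) (hx : x ∈ U), ψ x = J1.prolong h x hx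

namespace MultivectorField

variable (X : MultivectorField (JetModel m k) m (J1 B))

/-- `X` is holonomic iff it is integrable, `π̄¹`-transverse, and its integral sections are
holonomic. -/
structure IsHolonomic : Prop where
  isIntegrable : X.IsIntegrable
  isTransverse : X.IsTransverse J1.toBase
  holonomic : ∀ (U : Set M) (ψ : M → J1 B), X.IsIntegralSection J1.toBase U ψ →
    IsHolonomicSection U ψ

/-- `X` is a SOPDE (semi-holonomic) iff it is `π̄¹`-transverse and
`Λ^m κ ∘ X = Λ^m Tπ¹ ∘ X`. -/
structure IsSOPDE : Prop where
  isTransverse : X.IsTransverse J1.toBase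
  kappa_eq : ∀ p : J1 B, exteriorPower.map m p.kappa.toLinearMap (X.toFun p) =
    exteriorPower.map m (mfderiv 𝓘(ℝ, JetModel m k) (𝓡 n) J1.base p).toLinearMap (X.toFun p)

end MultivectorField

end Holonomic

end

/-! A local section `ψ` of `π̄¹` is a first prolongation exactly when the linear map stored in each
jet `ψ x` is the tangent map at `x` of `π¹ ∘ ψ`. Since `Tπ̄¹ ∘ Tψ = id`, that stored map is `κ ∘
Tψ`, so holonomy of `ψ` is the first-order condition `κ ∘ Tψ = Tπ¹ ∘ Tψ` (`isHolonomicSection_iff`).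
Along an integral section, `X` spans `Λ^m` of the image of `Tψ`, and the theorem compares this
condition with its `m`-th exterior power evaluated on `X`.

Passing to exterior powers is immediate. Going back is the point of the proof: equality of `Λ^m f`
and `Λ^m g` does not in general give `f = g`, but it does when `f` and `g` are both sections of one
linear map onto an `m`-dimensional space (`LinearMap.eq_of_exteriorPower_map_eq`). Here `κ ∘ Tψ` and
`Tπ¹ ∘ Tψ` both split `Tπ`, so SOPDE forces every integral section to be holonomic.

For the other direction the SOPDE identity is needed at every point of `J¹E`, so an integral section
is needed through every point. Integrability gives an integral manifold; transversality makes its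
projection to `M` a local diffeomorphism, and a local inverse turns it into a section
(`IsIntegralManifold.exists_isIntegralSection`). -/

open scoped Manifold ContDiff

/-! ### Linear maps and their top exterior powers -/

section LinearAlgebra

open Module

variable {K V W : Type*} [Field K] [AddCommGroup V] [Module K V] [AddCommGroup W] [Module K W]
  {m : ℕ}

/-- The action of an endomorphism on the top exterior power is detected by its determinant. -/
theorem LinearMap.det_eq_det_of_exteriorPower_map_eq (b : Basis (Fin m) K V) {f g : V →ₗ[K] V}
    (h : exteriorPower.map m f = exteriorPower.map m g) : LinearMap.det f = LinearMap.det g := by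
  -- Pairing `Λ^m f (b₁ ∧ ⋯ ∧ b_m)` with the volume form `b.det` gives exactly `det f`.
  have h1 := congrArg (fun F => exteriorPower.alternatingMapLinearEquiv b.det
    (F (exteriorPower.ιMulti K m b))) h
  simp only [exteriorPower.map_apply_ιMulti,
    exteriorPower.alternatingMapLinearEquiv_apply_ιMulti, Module.Basis.det_comp,
    Module.Basis.det_self, mul_one] at h1
  exact h1

/-- Two sections of a linear map onto an `m`-dimensional space agree as soon as they induce the
same map on `m`-th exterior powers. -/
theorem LinearMap.eq_of_exteriorPower_map_eq (b : Basis (Fin m) K V) {f g : V →ₗ[K] W}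
    {p : W →ₗ[K] V} (hf : p ∘ₗ f = LinearMap.id) (hg : p ∘ₗ g = LinearMap.id)
    (h : exteriorPower.map m f = exteriorPower.map m g) : f = g := by
  have : FiniteDimensional K V := b.finiteDimensional_of_finite
  ext v
  rw [← sub_eq_zero, ← Module.forall_dual_apply_eq_zero_iff K]
  intro l
  -- `T` perturbs `p` by a rank-one term that vanishes on the image of `g`. Hence `T ∘ g = id`,
  -- while `T ∘ f` is a transvection of determinant `1 + l (f v - g v)`; equal determinants give `l
  -- (f v - g v) = 0`.
  let T : W →ₗ[K] V := p + (l ∘ₗ (LinearMap.id - g ∘ₗ p)).smulRight v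
  have hpf : ∀ u, p (f u) = u := fun u => LinearMap.congr_fun hf u
  have hpg : ∀ u, p (g u) = u := fun u => LinearMap.congr_fun hg u
  have hTf : T ∘ₗ f = LinearMap.transvection (l ∘ₗ (f - g)) v := by
    ext u
    simp [T, LinearMap.transvection.apply, hpf]
  have hTg : T ∘ₗ g = LinearMap.id := by
    ext u
    simp [T, hpg]
  have hd := LinearMap.det_eq_det_of_exteriorPower_map_eq b (f := T ∘ₗ f) (g := T ∘ₗ g)
    (by rw [exteriorPower.map_comp, exteriorPower.map_comp, h])
  rw [hTf, hTg, LinearMap.transvection.det, LinearMap.det_id] at hd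
  simpa using hd

/-- If some top-degree form does not vanish on an `m`-vector in the image of `f` after pulling back
by `p`, then `p ∘ f` is injective. -/
theorem LinearMap.injective_comp_of_exteriorPower (b : Basis (Fin m) K V) {f : V →ₗ[K] W}
    {p : W →ₗ[K] V} {z : ⋀[K]^m W} (hz : z ∈ LinearMap.range (exteriorPower.map m f))
    (h : exteriorPower.alternatingMapLinearEquiv (b.det.compLinearMap p) z ≠ 0) :
    Function.Injective (p ∘ₗ f) := by
  have : FiniteDimensional K V := b.finiteDimensional_of_finite
  obtain ⟨w, rfl⟩ := hz
  -- Pulling the volume form back along the endomorphism `p ∘ f` multiplies it by the determinant,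
  -- so a nonzero value forces a nonzero determinant.
  have h1 : exteriorPower.alternatingMapLinearEquiv (b.det.compLinearMap p) ∘ₗ
      exteriorPower.map m f = LinearMap.det (p ∘ₗ f) •
        exteriorPower.alternatingMapLinearEquiv b.det := by
    apply exteriorPower.linearMap_ext
    ext v
    have := b.det_comp (p ∘ₗ f) v
    simpa [exteriorPower.map_apply_ιMulti, Function.comp_def] using this
  have h2 : LinearMap.det (p ∘ₗ f) ≠ 0 := by
    intro h0
    apply h
    have := LinearMap.congr_fun h1 w
    rw [h0, zero_smul] at this
    exact this
  exact (LinearMap.equivOfDetNeZero (p ∘ₗ f) h2).injective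

/-- This puts the previous criterion in the form in which transversality is stated. The equivalence
`e` allows the target of `p` to be the tangent space at another point than the source of `f`. -/
theorem LinearMap.injective_comp_of_forall_alternatingMap {V' : Type*} [AddCommGroup V']
    [Module K V'] (b : Basis (Fin m) K V) (e : V' ≃ₗ[K] V) {f : V →ₗ[K] W} {p : W →ₗ[K] V'}
    {z : ⋀[K]^m W} (hz : Submodule.span K {z} = LinearMap.range (exteriorPower.map m f))
    (h : ∀ α : V' [⋀^Fin m]→ₗ[K] K, α ≠ 0 →
      exteriorPower.alternatingMapLinearEquiv (α.compLinearMap p) z ≠ 0) :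
    Function.Injective (p ∘ₗ f) := by
  have h1 : b.det.compLinearMap e.toLinearMap ≠ 0 := by
    intro h0
    -- On the basis transported by `e.symm` the form takes the value 1.
    have := congrArg (fun β : V' [⋀^Fin m]→ₗ[K] K => β (e.symm ∘ b)) h0
    simp [Function.comp_def, b.det_self] at this
  have h2 := LinearMap.injective_comp_of_exteriorPower b (f := f) (p := e.toLinearMap ∘ₗ p)
    (hz ▸ Submodule.mem_span_singleton_self z)
    (by rw [← AlternatingMap.compLinearMap_assoc]; exact h _ h1)
  exact Function.Injective.of_comp (f := e) h2

theorem exteriorPower.map_eq_map_of_comp_eq {U : Type*} [AddCommGroup U] [Module K U]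
    {a : V →ₗ[K] W} {f g : W →ₗ[K] U} (h : f ∘ₗ a = g ∘ₗ a) {z : ⋀[K]^m W}
    (hz : Submodule.span K {z} = LinearMap.range (exteriorPower.map m a)) :
    exteriorPower.map m f z = exteriorPower.map m g z := by
  have hmem : z ∈ LinearMap.range (exteriorPower.map m a) :=
    hz ▸ Submodule.mem_span_singleton_self z
  obtain ⟨w, rfl⟩ := hmem
  rw [← LinearMap.comp_apply, ← LinearMap.comp_apply, ← exteriorPower.map_comp,
    ← exteriorPower.map_comp, h]

/-- The image of `Λ^m a` is the line through `z`, so agreement of `Λ^m f` and `Λ^m g` at the single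
vector `z` gives agreement of `Λ^m (f ∘ a)` and `Λ^m (g ∘ a)` everywhere. Both composites are
sections of `p`, so the rigidity of sections applies. -/
theorem LinearMap.comp_eq_comp_of_exteriorPower_map_eq {U : Type*} [AddCommGroup U] [Module K U]
    (b : Basis (Fin m) K V) {a : V →ₗ[K] W} {f g : W →ₗ[K] U} {p : U →ₗ[K] V}
    (hf : ∀ v, p (f (a v)) = v) (hg : ∀ v, p (g (a v)) = v) {z : ⋀[K]^m W}
    (hz : Submodule.span K {z} = LinearMap.range (exteriorPower.map m a))
    (h : exteriorPower.map m f z = exteriorPower.map m g z) : f ∘ₗ a = g ∘ₗ a := by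
  refine LinearMap.eq_of_exteriorPower_map_eq b (p := p) (LinearMap.ext hf) (LinearMap.ext hg) ?_
  rw [exteriorPower.map_comp, exteriorPower.map_comp]
  refine LinearMap.ext fun w => ?_
  have hw : exteriorPower.map m a w ∈ Submodule.span K {z} := hz ▸ LinearMap.mem_range_self _ w
  obtain ⟨c, hc⟩ := Submodule.mem_span_singleton.mp hw
  rw [LinearMap.comp_apply, LinearMap.comp_apply, ← hc, map_smul, map_smul, h]

/-- Used to see that reparametrizing an integral manifold does not change the line of its tangent
`m`-vectors. -/
theorem exteriorPower.range_map_comp_of_surjective {U : Type*} [AddCommGroup U] [Module K U]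
    {f : V →ₗ[K] W} (hf : Function.Surjective f) (g : W →ₗ[K] U) :
    LinearMap.range (exteriorPower.map m (g ∘ₗ f)) = LinearMap.range (exteriorPower.map m g) := by
  rw [exteriorPower.map_comp]
  exact LinearMap.range_comp_of_range_eq_top _
    (LinearMap.range_eq_top.mpr (exteriorPower.map_surjective hf))

end LinearAlgebra

/-! ### Local right inverses of smooth maps with invertible tangent maps -/

section InverseFunction

variable {V : Type*} [NormedAddCommGroup V] [NormedSpace ℝ V] [CompleteSpace V]
  {S M : Type*} [TopologicalSpace S] [ChartedSpace V S] [IsManifold 𝓘(ℝ, V) ∞ S]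
  [TopologicalSpace M] [ChartedSpace V M] [IsManifold 𝓘(ℝ, V) ∞ M]

/-- The inverse function theorem on manifolds: a smooth map whose tangent maps are invertible
has a smooth local right inverse through each point. -/
theorem ContMDiff.exists_local_rightInverse {f : S → M} (hf : ContMDiff 𝓘(ℝ, V) 𝓘(ℝ, V) ∞ f)
    (hf' : ∀ s, (mfderiv 𝓘(ℝ, V) 𝓘(ℝ, V) f s).IsInvertible) (s : S) :
    ∃ (U : Set M) (σ : M → S), IsOpen U ∧ f s ∈ U ∧ ContMDiffOn 𝓘(ℝ, V) 𝓘(ℝ, V) ∞ σ U ∧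
      σ (f s) = s ∧ ∀ x ∈ U, f (σ x) = x := by
  let a := chartAt V s
  let c := chartAt V (f s)
  have hs : s ∈ a.source := mem_chart_source V s
  have hc : f s ∈ c.source := mem_chart_source V (f s)
  let g : V → V := c ∘ f ∘ a.symm
  let D : Set V := a.target ∩ a.symm ⁻¹' (f ⁻¹' c.source)
  have hD : IsOpen D := a.symm.isOpen_inter_preimage (c.open_source.preimage hf.continuous)
  have hg : ContDiffOn ℝ ∞ g D := by
    rw [← contMDiffOn_iff_contDiffOn]
    refine (contMDiffOn_chart (I := 𝓘(ℝ, V))).comp (hf.comp_contMDiffOn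
      ((contMDiffOn_chart_symm (I := 𝓘(ℝ, V)) (x := s)).mono Set.inter_subset_left)) ?_
    exact fun v hv => hv.2
  have hgAt : ∀ v ∈ D, ContDiffAt ℝ ∞ g v := fun v hv => hg.contDiffAt (hD.mem_nhds hv)
  -- Invertibility is recorded on all of `D`, not only at `a s`: smoothness of the inverse on a
  -- whole open set requires it at every nearby point.
  have hg' : ∀ v ∈ D, ∃ e : V ≃L[ℝ] V, HasFDerivAt g (e : V →L[ℝ] V) v := by
    intro v hv
    have ha := mdifferentiable_chart (I := 𝓘(ℝ, V)) s
    have hcm := mdifferentiable_chart (I := 𝓘(ℝ, V)) (f s)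
    obtain ⟨e, he⟩ := hf' (a.symm v)
    refine ⟨((ha.symm.mfderiv hv.1).trans e).trans (hcm.mfderiv hv.2), ?_⟩
    have h1 := (ha.mdifferentiableAt_symm hv.1).hasMFDerivAt
    have h2 := ((hf (a.symm v)).mdifferentiableAt (by simp)).hasMFDerivAt
    have h3 := (hcm.mdifferentiableAt hv.2).hasMFDerivAt
    have h4 := (h3.comp v (h2.comp v h1)).hasFDerivAt
    rw [← he] at h4
    exact h4
  have haD : a s ∈ D := ⟨a.map_source hs, by
    change f (a.symm (a s)) ∈ c.source
    rwa [a.left_inv hs]⟩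
  have hgs : g (a s) = c (f s) := by
    change c (f (a.symm (a s))) = _
    rw [a.left_inv hs]
  obtain ⟨e, he⟩ := hg' _ haD
  let G := (hgAt _ haD).toOpenPartialHomeomorph g he (by simp)
  have hG : a s ∈ G.source :=
    ContDiffAt.mem_toOpenPartialHomeomorph_source (hgAt _ haD) he (by simp)
  have hG' : c (f s) ∈ G.target := hgs ▸ G.map_source hG
  have hGs : G.symm (c (f s)) = a s := hgs ▸ G.left_inv hG
  -- The source of `G` need not lie in `D`. Restricting to points whose preimage is in `D` keeps `g`
  -- smooth with invertible derivative there.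
  let O : Set V := G.target ∩ G.symm ⁻¹' D
  have hO : IsOpen O := G.symm.isOpen_inter_preimage hD
  have hsymm : ContDiffOn ℝ ∞ G.symm O := by
    intro w hw
    obtain ⟨e', he'⟩ := hg' _ hw.2
    exact (G.contDiffAt_symm hw.1 he' (hgAt _ hw.2)).contDiffWithinAt
  refine ⟨c.source ∩ c ⁻¹' O, fun x => a.symm (G.symm (c x)), c.isOpen_inter_preimage hO,
    ⟨hc, hG', ?_⟩, ?_, ?_, ?_⟩
  · change G.symm (c (f s)) ∈ D
    rwa [hGs]
  · refine (contMDiffOn_chart_symm (I := 𝓘(ℝ, V)) (x := s)).comp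
      (hsymm.contMDiffOn.comp ((contMDiffOn_chart (I := 𝓘(ℝ, V))).mono Set.inter_subset_left)
        (fun x hx => hx.2)) ?_
    exact fun x hx => hx.2.2.1
  · change a.symm (G.symm (c (f s))) = s
    rw [hGs, a.left_inv hs]
  · intro x hx
    apply c.injOn hx.2.2.2 hx.1
    exact G.right_inv hx.2.1

end InverseFunction

/-! ### Holonomic sections as a first-order condition -/

section Jet

variable {m k n : ℕ} {M E F : Type*}
  [TopologicalSpace M] [ChartedSpace (EuclideanSpace ℝ (Fin m)) M] [IsManifold (𝓡 m) ∞ M]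
  [TopologicalSpace E] [ChartedSpace (EuclideanSpace ℝ (Fin n)) E] [IsManifold (𝓡 n) ∞ E]
  [TopologicalSpace F] [ChartedSpace (EuclideanSpace ℝ (Fin k)) F] [IsManifold (𝓡 k) ∞ F]
  {B : SmoothFiberBundle m k n M E F}

theorem J1.contMDiff_toBase :
    ContMDiff 𝓘(ℝ, JetModel m k) (𝓡 m) ∞ (J1.toBase (B := B)) :=
  B.contMDiff_proj.comp J1.contMDiff_base

/-- The tangent maps of a local section, read in the model spaces, split the projection. -/
theorem IsLocalSection.mfderiv_comp_mfderiv {V P : Type*} [NormedAddCommGroup V] [NormedSpace ℝ V]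
    [TopologicalSpace P] [ChartedSpace V P] {p : P → M} {U : Set M} {σ : M → P}
    (h : IsLocalSection m V p U σ) {x : M} (hx : x ∈ U)
    (hp : MDifferentiableAt 𝓘(ℝ, V) (𝓡 m) p (σ x)) :
    ((mfderiv 𝓘(ℝ, V) (𝓡 m) p (σ x) : V →L[ℝ] EuclideanSpace ℝ (Fin m)).comp
      (mfderiv (𝓡 m) 𝓘(ℝ, V) σ x : EuclideanSpace ℝ (Fin m) →L[ℝ] V)) =
      ContinuousLinearMap.id ℝ (EuclideanSpace ℝ (Fin m)) := by
  have h1 : MDifferentiableAt (𝓡 m) 𝓘(ℝ, V) σ x :=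
    ((h.smooth x hx).contMDiffAt (h.isOpen.mem_nhds hx)).mdifferentiableAt (by simp)
  have h2 := mfderiv_comp x hp h1
  have h3 : (p ∘ σ) =ᶠ[nhds x] id := by
    filter_upwards [h.isOpen.mem_nhds hx] with z hz using h.proj z hz
  rw [h3.mfderiv_eq, mfderiv_id] at h2
  exact h2.symm

/-- The underlying section `π¹ ∘ ψ` of a local section `ψ` of `π̄¹`. -/
theorem IsLocalSection.base {U : Set M} {ψ : M → J1 B}
    (h : IsLocalSection m (JetModel m k) J1.toBase U ψ) :
    IsLocalSection m (EuclideanSpace ℝ (Fin n)) B.proj U (fun x => (ψ x).base) where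
  isOpen := h.isOpen
  smooth := J1.contMDiff_base.comp_contMDiffOn h.smooth
  proj := h.proj

theorem IsLocalSection.mfderiv_base {U : Set M} {ψ : M → J1 B}
    (h : IsLocalSection m (JetModel m k) J1.toBase U ψ) {x : M} (hx : x ∈ U) :
    mfderiv (𝓡 m) (𝓡 n) (fun x => (ψ x).base) x =
      (mfderiv 𝓘(ℝ, JetModel m k) (𝓡 n) J1.base (ψ x)).comp
        (mfderiv (𝓡 m) 𝓘(ℝ, JetModel m k) ψ x) :=
  mfderiv_comp x ((J1.contMDiff_base (ψ x)).mdifferentiableAt (by simp))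
    (((h.smooth x hx).contMDiffAt (h.isOpen.mem_nhds hx)).mdifferentiableAt (by simp))

/-- By definition `κ` is the stored linear map after `Tπ̄¹`, and `Tπ̄¹ ∘ Tψ = id`. The type
ascription identifies the tangent spaces at `π̄¹ (ψ x)` and at `x`, both of which are the model
space. -/
theorem IsLocalSection.kappa_comp_mfderiv {U : Set M} {ψ : M → J1 B}
    (h : IsLocalSection m (JetModel m k) J1.toBase U ψ) {x : M} (hx : x ∈ U) :
    (ψ x).kappa.comp (mfderiv (𝓡 m) 𝓘(ℝ, JetModel m k) ψ x) =
      (show EuclideanSpace ℝ (Fin m) →L[ℝ] EuclideanSpace ℝ (Fin n) from (ψ x).lin) := by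
  have h1 := h.mfderiv_comp_mfderiv hx
    ((J1.contMDiff_toBase (B := B) (ψ x)).mdifferentiableAt (by simp))
  change (show EuclideanSpace ℝ (Fin m) →L[ℝ] EuclideanSpace ℝ (Fin n) from (ψ x).lin).comp
    ((mfderiv 𝓘(ℝ, JetModel m k) (𝓡 m) (J1.toBase (B := B)) (ψ x) :
      JetModel m k →L[ℝ] EuclideanSpace ℝ (Fin m)).comp
      (mfderiv (𝓡 m) 𝓘(ℝ, JetModel m k) ψ x :
        EuclideanSpace ℝ (Fin m) →L[ℝ] JetModel m k)) = _
  rw [h1]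
  rfl

/-- A local section of `π̄¹` is holonomic iff its values are the tangent maps of the underlying
section of `π`, that is, iff `κ ∘ Tψ = Tπ¹ ∘ Tψ`. -/
theorem isHolonomicSection_iff {U : Set M} {ψ : M → J1 B}
    (h : IsLocalSection m (JetModel m k) J1.toBase U ψ) :
    IsHolonomicSection U ψ ↔ ∀ x ∈ U,
      (ψ x).kappa.comp (mfderiv (𝓡 m) 𝓘(ℝ, JetModel m k) ψ x) =
        (mfderiv 𝓘(ℝ, JetModel m k) (𝓡 n) J1.base (ψ x)).comp
          (mfderiv (𝓡 m) 𝓘(ℝ, JetModel m k) ψ x) := by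
  constructor
  · rintro ⟨φ, hφ, hψ⟩ x hx
    rw [← h.mfderiv_base hx]
    refine (h.kappa_comp_mfderiv hx).trans ?_
    -- The two maps are only known to agree on the open set `U`, which suffices for their
    -- derivatives at `x`.
    have h1 : (fun x => (ψ x).base) =ᶠ[nhds x] φ := by
      filter_upwards [h.isOpen.mem_nhds hx] with z hz
      rw [hψ z hz]
      rfl
    rw [h1.mfderiv_eq, hψ x hx]
    rfl
  · intro H
    -- The only candidate for `φ` is `π¹ ∘ ψ`; base points then agree by definition and only the
    -- linear parts remain.
    refine ⟨_, h.base, fun x hx => J1.ext_of_eq rfl ?_⟩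
    refine (h.kappa_comp_mfderiv hx).symm.trans ((H x hx).trans ?_)
    exact (h.mfderiv_base hx).symm

/-! ### Integral sections of transverse multivector fields, and the two implications -/

namespace MultivectorField

/-- Through each point of an integral manifold of a transverse multivector field there passes an
integral section. -/
theorem IsIntegralManifold.exists_isIntegralSection {V N : Type*} [NormedAddCommGroup V]
    [NormedSpace ℝ V] [TopologicalSpace N] [ChartedSpace V N] [IsManifold 𝓘(ℝ, V) ∞ N]
    {X : MultivectorField V m N} {p : N → M} (hp : ContMDiff 𝓘(ℝ, V) (𝓡 m) ∞ p)
    (hX : X.IsTransverse p) {S : Type*} [TopologicalSpace S]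
    [ChartedSpace (EuclideanSpace ℝ (Fin m)) S] [IsManifold (𝓡 m) ∞ S] {ι : S → N}
    (hι : X.IsIntegralManifold ι) (s : S) :
    ∃ (U : Set M) (ψ : M → N), X.IsIntegralSection p U ψ ∧ ∃ x ∈ U, ψ x = ι s := by
  have hιd : ∀ s, MDifferentiableAt (𝓡 m) 𝓘(ℝ, V) ι s :=
    fun s => (hι.smooth s).mdifferentiableAt (by simp)
  have hinv : ∀ s, (mfderiv (𝓡 m) (𝓡 m) (p ∘ ι) s).IsInvertible := by
    intro s
    let b : Module.Basis (Fin m) ℝ (TangentSpace (𝓡 m) s) :=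
      (EuclideanSpace.basisFun (Fin m) ℝ).toBasis
    -- Tangent spaces of `M` and `S` are both the model space, so the identity serves as the
    -- equivalence.
    let e : TangentSpace (𝓡 m) (p (ι s)) ≃ₗ[ℝ] TangentSpace (𝓡 m) s :=
      LinearEquiv.refl ℝ (EuclideanSpace ℝ (Fin m))
    have hinj := LinearMap.injective_comp_of_forall_alternatingMap b e (hι.span_eq s) (hX (ι s))
    have h1 := mfderiv_comp s ((hp (ι s)).mdifferentiableAt (by simp)) (hιd s)
    rw [h1]
    let L : EuclideanSpace ℝ (Fin m) →ₗ[ℝ] EuclideanSpace ℝ (Fin m) :=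
      (mfderiv 𝓘(ℝ, V) (𝓡 m) p (ι s)).toLinearMap ∘ₗ (mfderiv (𝓡 m) 𝓘(ℝ, V) ι s).toLinearMap
    have hL : Function.Injective L := hinj
    refine ⟨(LinearEquiv.ofInjectiveEndo L hL).toContinuousLinearEquiv, ?_⟩
    exact ContinuousLinearMap.ext fun v => rfl
  obtain ⟨U, σ, hU, hsU, hσ, hσs, hσr⟩ :=
    (hp.comp hι.smooth).exists_local_rightInverse hinv s
  refine ⟨U, ι ∘ σ, ⟨⟨hU, hι.smooth.comp_contMDiffOn hσ, hσr⟩, ?_⟩, _, hsU, congrArg ι hσs⟩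
  intro x hx
  -- Seen as a section of `p ∘ ι`, the map `σ` has a tangent map with a left inverse; equality of
  -- dimensions makes it surjective, so `ι ∘ σ` and `ι` have the same tangent `m`-vectors.
  have hsec : IsLocalSection m (EuclideanSpace ℝ (Fin m)) (p ∘ ι) U σ := ⟨hU, hσ, hσr⟩
  have h1 := hsec.mfderiv_comp_mfderiv hx
    (((hp.comp hι.smooth) (σ x)).mdifferentiableAt (by simp))
  have hσd : MDifferentiableAt (𝓡 m) (𝓡 m) σ x :=
    ((hσ x hx).contMDiffAt (hU.mem_nhds hx)).mdifferentiableAt (by simp)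
  let dσ : EuclideanSpace ℝ (Fin m) →ₗ[ℝ] EuclideanSpace ℝ (Fin m) :=
    (mfderiv (𝓡 m) (𝓡 m) σ x).toLinearMap
  have hinj : Function.Injective dσ :=
    Function.LeftInverse.injective (fun v => DFunLike.congr_fun h1 v)
  have hsurj : Function.Surjective dσ := LinearMap.injective_iff_surjective.mp hinj
  rw [Function.comp_apply, hι.span_eq (σ x), mfderiv_comp x (hιd (σ x)) hσd]
  exact (exteriorPower.range_map_comp_of_surjective (f := (mfderiv (𝓡 m) (𝓡 m) σ x).toLinearMap)
    hsurj _).symm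

variable {X : MultivectorField (JetModel m k) m (J1 B)}

/-- Both `κ ∘ Tψ` and `Tπ¹ ∘ Tψ` split `Tπ`: the first because it is the linear part of a jet, the
second because `π¹ ∘ ψ` is a section of `π`. The SOPDE identity equates their exterior powers, hence
the maps themselves. -/
theorem IsSOPDE.isHolonomicSection (hX : X.IsSOPDE) {U : Set M} {ψ : M → J1 B}
    (hψ : X.IsIntegralSection J1.toBase U ψ) : IsHolonomicSection U ψ := by
  rw [isHolonomicSection_iff hψ.isLocalSection]
  intro x hx
  have hloc := hψ.isLocalSection
  let p : TangentSpace (𝓡 n) (ψ x).base →ₗ[ℝ] TangentSpace (𝓡 m) x :=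
    (AdaptedChart.dproj B (ψ x).base).toLinearMap
  let b : Module.Basis (Fin m) ℝ (TangentSpace (𝓡 m) x) :=
    (EuclideanSpace.basisFun (Fin m) ℝ).toBasis
  have h1 : ∀ v : TangentSpace (𝓡 m) x,
      p ((ψ x).kappa (mfderiv (𝓡 m) 𝓘(ℝ, JetModel m k) ψ x v)) = v := by
    intro v
    refine (congrArg p (DFunLike.congr_fun (hloc.kappa_comp_mfderiv hx) v)).trans ?_
    exact DFunLike.congr_fun (ψ x).proj_lin v
  have h2 : ∀ v : TangentSpace (𝓡 m) x,
      p (mfderiv 𝓘(ℝ, JetModel m k) (𝓡 n) J1.base (ψ x)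
        (mfderiv (𝓡 m) 𝓘(ℝ, JetModel m k) ψ x v)) = v := by
    intro v
    refine (congrArg p (DFunLike.congr_fun (hloc.mfderiv_base hx) v)).symm.trans ?_
    exact DFunLike.congr_fun
      (hloc.base.mfderiv_comp_mfderiv hx (AdaptedChart.mdiff_proj B (ψ x).base)) v
  exact ContinuousLinearMap.coe_injective (LinearMap.comp_eq_comp_of_exteriorPower_map_eq b h1 h2
    (hψ.span_eq x hx) (hX.kappa_eq (ψ x)))

theorem IsIntegralSection.kappa_eq {U : Set M} {ψ : M → J1 B}
    (hψ : X.IsIntegralSection J1.toBase U ψ) (hol : IsHolonomicSection U ψ) {x : M} (hx : x ∈ U) :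
    exteriorPower.map m (ψ x).kappa.toLinearMap (X.toFun (ψ x)) =
      exteriorPower.map m (mfderiv 𝓘(ℝ, JetModel m k) (𝓡 n) J1.base (ψ x)).toLinearMap
        (X.toFun (ψ x)) :=
  exteriorPower.map_eq_map_of_comp_eq
    (congrArg ContinuousLinearMap.toLinearMap
      ((isHolonomicSection_iff hψ.isLocalSection).mp hol x hx))
    (hψ.span_eq x hx)

theorem IsIntegrable.exists_isIntegralSection (hX : X.IsIntegrable)
    (hX' : X.IsTransverse J1.toBase) (q : J1 B) :
    ∃ (U : Set M) (ψ : M → J1 B), X.IsIntegralSection J1.toBase U ψ ∧ ∃ x ∈ U, ψ x = q := by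
  obtain ⟨S, _, _, _, ι, hι, s, hs⟩ := hX q
  rw [← hs]
  exact hι.exists_isIntegralSection J1.contMDiff_toBase hX' s

/-- The identity to prove is pointwise, so one integral section through each jet suffices; that
section is holonomic by assumption. -/
theorem IsHolonomic.isSOPDE (hX : X.IsHolonomic) : X.IsSOPDE := by
  refine ⟨hX.isTransverse, fun q => ?_⟩
  obtain ⟨U, ψ, hψ, x, hx, rfl⟩ := hX.isIntegrable.exists_isIntegralSection hX.isTransverse q
  exact hψ.kappa_eq (hX.holonomic U ψ hψ) hx

end MultivectorField

end Jet

theorem mainTheorem4 {m k n : ℕ} {M E F : Type*}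
    [TopologicalSpace M] [ChartedSpace (EuclideanSpace ℝ (Fin m)) M] [IsManifold (𝓡 m) ∞ M]
    [TopologicalSpace E] [ChartedSpace (EuclideanSpace ℝ (Fin n)) E] [IsManifold (𝓡 n) ∞ E]
    [TopologicalSpace F] [ChartedSpace (EuclideanSpace ℝ (Fin k)) F] [IsManifold (𝓡 k) ∞ F]
    (B : SmoothFiberBundle m k n M E F)
    (X : MultivectorField (JetModel m k) m (J1 B)) :
    X.IsHolonomic ↔ X.IsIntegrable ∧ X.IsSOPDE := by
  exact ⟨fun h => ⟨h.isIntegrable, h.isSOPDE⟩, fun h =>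
    ⟨h.1, h.2.isTransverse, fun _ _ hψ => h.2.isHolonomicSection hψ⟩⟩
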